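/- Let $G$ be a finite simple graph with $n$ vertices. Suppose that $G$ is $3$-connected (that is, $n \ge 4$ and deleting any set of at most two vertices leaves a connected graph) and that every edge of $G$ lies in a triangle of $G$. Then $G$ has at least $2n-2$ edges. Moreover, $G$ has exactly $2n-2$ edges if and only if $G$ is isomorphic to the wheel $W_n = K_1 \vee C_{n-1}$, the graph obtained from a cycle on $n-1$ vertices by adding one new vertex adjacent to all vertices of the cycle. -/

import Mathlib

namespace SimpleGraph

/-- A graph is `k`-connected if it has more than `k` vertices and deleting any set of fewer
than `k` vertices leaves a connected graph. -/
def IsVertexConnected {V : Type*} (G : SimpleGraph V) [Fintype V] (k : ℕ) : Prop :=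
  k < Fintype.card V ∧ ∀ S : Finset V, S.card < k → (G.induce {v | v ∉ S}).Connected

/-- Every edge lies in a triangle, that is, the two ends of each edge belong to a common
set of three mutually adjacent vertices. -/
def EveryEdgeInTriangle {V : Type*} (G : SimpleGraph V) : Prop :=
  ∀ u v : V, G.Adj u v → ∃ T : Finset V, G.IsNClique 3 T ∧ u ∈ T ∧ v ∈ T

/-- The join of two graphs: the disjoint union together with all edges between the two parts. -/
def join {V W : Type*} (G : SimpleGraph V) (H : SimpleGraph W) : SimpleGraph (V ⊕ W) :=
  (G ⊕g H) ⊔ completeBipartiteGraph V W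

/-- The wheel of order `n`: the join of `K₁` and the cycle of order `n - 1` (for `n ≥ 4`). -/
def wheelGraph (n : ℕ) : SimpleGraph (Fin 1 ⊕ Fin (n - 1)) :=
  join (completeGraph (Fin 1)) (cycleGraph (n - 1))

end SimpleGraph

namespace SimpleGraph

/-! Induction on the order `n`. By `3`-connectivity every degree is at least three. If all degrees
are at least four, there are at least `2n` edges. Otherwise take `v` of degree three. As the edges
at `v` lie in triangles, its neighbours contain a path `a`, `b`, `c`. Deleting `v` and joining `a`
to `c` (`eliminate`) keeps both hypotheses when `n ≥ 5`, and costs three edges while gaining at most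
one, so the bound passes from `n - 1` to `n`.

Equality at `n` forces `ac` to be a new edge and equality at `n - 1`, where induction supplies a
dominating vertex. The degree sum then makes all other degrees three, and a local analysis shows
that `b` dominates `G`. The same degree sum in `G` leaves a connected `2`-regular graph, hence a
cycle, once the dominating vertex is removed. -/

variable {V : Type*}

/-! ### Recognising a cycle -/

/-- A connected `2`-regular finite graph is a cycle. -/
theorem Connected.nonempty_iso_cycleGraph [Fintype V] {H : SimpleGraph V} [H.LocallyFinite]
    (hc : H.Connected) (hd : H.IsRegularOfDegree 2) :
    Nonempty (cycleGraph (Fintype.card V) ≃g H) := by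
  classical
  have hdeg_cycle : ∀ {k : ℕ}, 3 ≤ k → ∀ i, (cycleGraph k).degree i = 2 := by
    intro k hk i
    obtain ⟨m, rfl⟩ := Nat.exists_eq_add_of_le' hk
    exact cycleGraph_degree_three_le
  obtain ⟨v⟩ := hc.nonempty
  have hcyc : H.IsCycles := by
    intro w _
    rw [← hd w, ← card_neighborSet_eq_degree, Set.ncard_eq_toFinset_card', Set.toFinset_card]
  have hne : (H.neighborSet v).Nonempty := by
    have : 0 < H.degree v := by rw [hd v]; norm_num
    obtain ⟨w, hw⟩ := (H.degree_pos_iff_exists_adj v).1 this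
    exact ⟨w, hw⟩
  -- This cycle covers the whole component of `v`, which is all of `V`, so it is Hamiltonian.
  obtain ⟨p, hp, hverts⟩ := hcyc.exists_cycle_toSubgraph_verts_eq_connectedComponentSupp
    (c := H.connectedComponentMk v) rfl hne
  have hmem : ∀ w, w ∈ p.support := by
    intro w
    rw [← Walk.mem_verts_toSubgraph, hverts]
    exact ConnectedComponent.sound (hc.preconnected w v)
  have hham : p.IsHamiltonianCycle := by
    rw [Walk.isHamiltonianCycle_iff_isCycle_and_support_count_tail_eq_one]
    refine ⟨hp, fun w => List.count_eq_one_of_mem hp.support_nodup ?_⟩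
    rcases List.mem_cons.1 (p.cons_tail_support.symm ▸ hmem w) with rfl | h
    · exact Walk.end_mem_tail_support hp.not_nil
    · exact h
  have hlen := hham.length_eq
  have h3 : 3 ≤ Fintype.card V := hlen ▸ hp.three_le_length
  obtain ⟨f⟩ := (cycleGraph_isContained_iff h3).2 ⟨v, p, hp, hlen⟩
  have hbij : Function.Bijective f :=
    (Fintype.bijective_iff_injective_and_card _).2 ⟨f.injective, by simp⟩
  refine ⟨⟨Equiv.ofBijective f hbij, ?_⟩⟩
  intro i j
  refine ⟨fun h => ?_, fun h => f.toHom.map_adj h⟩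
  -- The images of the two cycle neighbours of `i` already exhaust the two neighbours of `f i`, so
  -- `f` also reflects adjacency.
  have hsub : ((cycleGraph (Fintype.card V)).neighborFinset i).map ⟨f, f.injective⟩ ⊆
      H.neighborFinset (f i) := by
    intro x hx
    obtain ⟨k, hk, rfl⟩ := Finset.mem_map.1 hx
    rw [mem_neighborFinset] at hk ⊢
    exact f.toHom.map_adj hk
  have hdeg : (cycleGraph (Fintype.card V)).degree i = 2 := by
    exact hdeg_cycle h3 i
  have heq := Finset.eq_of_subset_of_card_le hsub (by
    rw [Finset.card_map, card_neighborFinset_eq_degree, card_neighborFinset_eq_degree, hd, hdeg])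
  have hj : f j ∈ H.neighborFinset (f i) := (mem_neighborFinset _ _ _).2 h
  rw [← heq] at hj
  obtain ⟨k, hk, hkj⟩ := Finset.mem_map.1 hj
  rw [← f.injective hkj]
  exact (mem_neighborFinset _ _ _).1 hk

/-! ### Working forms of the hypotheses -/

/-- Vertex connectivity in terms of vertex sets closed under adjacency. -/
theorem isVertexConnected_iff [Fintype V] {G : SimpleGraph V} {k : ℕ} :
    G.IsVertexConnected k ↔ k < Fintype.card V ∧ ∀ S : Finset V, S.card < k → ∀ A : Set V,
      (∀ x ∉ S, ∀ y ∉ S, G.Adj x y → x ∈ A → y ∈ A) → ∀ x ∉ S, ∀ y ∉ S, x ∈ A → y ∈ A := by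
  refine and_congr_right fun hk => forall_congr' fun S => imp_congr_right fun hS => ⟨?_, ?_⟩
  · intro hc A hA x hx y hy hxA
    obtain ⟨p⟩ := hc.preconnected ⟨x, hx⟩ ⟨y, hy⟩
    suffices ∀ u w : {v | v ∉ S}, (G.induce {v | v ∉ S}).Walk u w → u.1 ∈ A → w.1 ∈ A from
      this _ _ p hxA
    intro u w q
    induction q with
    | nil => exact id
    | @cons a b c h _ ih => exact fun hu => ih (hA _ a.2 _ b.2 h hu)
  · intro h
    obtain ⟨z, hz⟩ : ∃ z, z ∉ S := by
      by_contra! hall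
      have := Finset.card_le_card (fun z _ => hall z : Finset.univ ⊆ S)
      rw [Finset.card_univ] at this
      omega
    have : Nonempty {v | v ∉ S} := ⟨⟨z, hz⟩⟩
    refine Connected.mk fun x y => ?_
    obtain ⟨_, hr⟩ := h {w | ∃ hw : w ∉ S, (G.induce {v | v ∉ S}).Reachable x ⟨w, hw⟩}
      (fun a ha b hb hab ⟨_, hr⟩ => ⟨hb, hr.trans (Adj.reachable (by exact hab))⟩)
      x.1 x.2 y.1 y.2 ⟨x.2, Reachable.refl _⟩
    exact hr

/-- If `v` had fewer than `k` neighbours, deleting them would isolate it, so `V` would consist of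
`v` and its neighbours, at most `k` vertices. -/
theorem IsVertexConnected.le_degree [Fintype V] {G : SimpleGraph V} [G.LocallyFinite] {k : ℕ}
    (h : G.IsVertexConnected k) (v : V) : k ≤ G.degree v := by
  classical
  by_contra! hlt
  obtain ⟨hk, hS⟩ := isVertexConnected_iff.1 h
  have hv : v ∉ G.neighborFinset v := G.notMem_neighborFinset_self v
  have huniv : Finset.univ ⊆ insert v (G.neighborFinset v) := by
    intro y _
    by_contra hy
    rw [Finset.mem_insert, not_or] at hy
    refine hy.1 (hS (G.neighborFinset v) (by simpa using hlt) {v} ?_ v hv y hy.2 rfl)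
    rintro x - z hz hxz rfl
    exact absurd ((mem_neighborFinset _ _ _).2 hxz) hz
  have := Finset.card_le_card huniv
  rw [Finset.card_insert_of_notMem hv, Finset.card_univ, card_neighborFinset_eq_degree] at this
  omega

theorem everyEdgeInTriangle_iff {G : SimpleGraph V} :
    G.EveryEdgeInTriangle ↔ ∀ u v, G.Adj u v → ∃ w, G.Adj u w ∧ G.Adj v w := by
  classical
  refine forall_congr' fun u => forall_congr' fun v => imp_congr_right fun huv => ⟨?_, ?_⟩
  · rintro ⟨T, hT, hu, hv⟩
    have hcard : ((T.erase u).erase v).card = 1 := by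
      rw [Finset.card_erase_of_mem (Finset.mem_erase.2 ⟨huv.ne', hv⟩),
        Finset.card_erase_of_mem hu, hT.card_eq]
    obtain ⟨w, hw⟩ := Finset.card_pos.1 (hcard ▸ Nat.one_pos)
    obtain ⟨hwv, hwu, hw⟩ : w ≠ v ∧ w ≠ u ∧ w ∈ T := by simpa using hw
    exact ⟨w, hT.isClique hu hw hwu.symm, hT.isClique hv hw hwv.symm⟩
  · rintro ⟨w, huw, hvw⟩
    exact ⟨{u, v, w}, is3Clique_triple_iff.2 ⟨huv, huw, hvw⟩, by simp, by simp⟩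

/-! ### Eliminating a vertex -/

/-- The graph obtained from `G` by deleting the vertex `v` and making its neighbourhood a
clique. -/
def eliminate (G : SimpleGraph V) (v : V) : SimpleGraph {x // x ≠ v} where
  Adj x y := x ≠ y ∧ (G.Adj x y ∨ G.Adj v x ∧ G.Adj v y)
  symm := ⟨fun _ _ h => ⟨h.1.symm, h.2.imp Adj.symm And.symm⟩⟩
  loopless := ⟨fun _ h => h.1 rfl⟩

theorem eliminate_adj {G : SimpleGraph V} {v : V} {x y : {x // x ≠ v}} :
    (G.eliminate v).Adj x y ↔ x ≠ y ∧ (G.Adj x y ∨ G.Adj v x ∧ G.Adj v y) := Iff.rfl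

theorem Adj.eliminate {G : SimpleGraph V} {v : V} {x y : {x // x ≠ v}} (h : G.Adj x y) :
    (G.eliminate v).Adj x y := ⟨fun e => h.ne (congrArg _ e), Or.inl h⟩

/-- A path of `G` through `v` can be short-cut, since the neighbours of `v` have become a clique; so
no new separator appears. -/
theorem IsVertexConnected.eliminate [Fintype V] [DecidableEq V] {G : SimpleGraph V} {k : ℕ}
    (h : G.IsVertexConnected k) (v : V) (hcard : k + 1 < Fintype.card V) :
    (G.eliminate v).IsVertexConnected k := by
  rw [isVertexConnected_iff] at h ⊢
  refine ⟨by rw [Fintype.card_subtype_compl, Fintype.card_subtype_eq]; omega, ?_⟩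
  intro S hS A hA x hx y hy hxA
  have hmem : ∀ z (hz : z ≠ v), z ∉ S.map (Function.Embedding.subtype _) → ⟨z, hz⟩ ∉ S := by
    intro z hz hzS hz'
    exact hzS (Finset.mem_map.2 ⟨_, hz', rfl⟩)
  have hmem' : ∀ z : {z // z ≠ v}, z ∉ S → z.1 ∉ S.map (Function.Embedding.subtype _) := by
    intro z hz hz'
    obtain ⟨w, hw, hwz⟩ := Finset.mem_map.1 hz'
    exact hz (Subtype.ext hwz ▸ hw)
  have key := h.2 (S.map (Function.Embedding.subtype _)) (by rwa [Finset.card_map])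
    -- The closed set `A` is lifted to `G` by adding `v` exactly when `v` has a neighbour in `A`
    -- outside `S`.
    {z | (∃ hz : z ≠ v, ⟨z, hz⟩ ∈ A) ∨ z = v ∧ ∃ w ∈ A, w ∉ S ∧ G.Adj v w} ?_
    x (hmem' x hx) y (hmem' y hy) (Or.inl ⟨x.2, hxA⟩)
  · rcases key with ⟨_, hy'⟩ | ⟨hy', _⟩
    · exact hy'
    · exact absurd hy' y.2
  · rintro p hp q hq hpq (⟨hpv, hpA⟩ | ⟨rfl, w, hwA, hwS, hw⟩)
    · by_cases hqv : q = v
      · subst hqv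
        exact Or.inr ⟨rfl, ⟨p, hpv⟩, hpA, hmem _ _ hp, hpq.symm⟩
      · exact Or.inl ⟨hqv, hA ⟨p, hpv⟩ (hmem _ _ hp) _ (hmem _ _ hq)
          (Adj.eliminate hpq) hpA⟩
    · refine Or.inl ⟨hpq.ne', ?_⟩
      by_cases hwq : w = ⟨q, hpq.ne'⟩
      · exact hwq ▸ hwA
      · exact hA w hwS _ (hmem _ _ hq) ⟨hwq, Or.inr ⟨hw, hpq⟩⟩ hwA

/-- The triangle on each edge at `v` gives every neighbour of `v` a neighbour among the other two,
and a graph on three vertices with none isolated contains a path; `b` is its middle. -/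
theorem exists_neighborFinset_eq_of_degree_eq_three {G : SimpleGraph V} [G.LocallyFinite]
    [DecidableEq V] (htri : G.EveryEdgeInTriangle) {v : V} (hv : G.degree v = 3) :
    ∃ a b c, a ≠ c ∧ G.Adj b a ∧ G.Adj b c ∧ G.neighborFinset v = {a, b, c} := by
  rw [everyEdgeInTriangle_iff] at htri
  obtain ⟨a, b, c, hab, hac, hbc, hN⟩ := Finset.card_eq_three.1 hv
  have hadj : ∀ x, G.Adj v x ↔ x = a ∨ x = b ∨ x = c := by
    intro x
    rw [← mem_neighborFinset, hN]
    simp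
  obtain ⟨x, hx, hax⟩ := htri v a ((hadj a).2 (by simp))
  obtain ⟨y, hy, hby⟩ := htri v b ((hadj b).2 (by simp))
  obtain ⟨z, hz, hcz⟩ := htri v c ((hadj c).2 (by simp))
  rw [hadj] at hx hy hz
  have hirr := @G.irrefl
  rcases hx with rfl | rfl | rfl
  · exact absurd hax (hirr)
  · rcases hz with rfl | rfl | rfl
    · exact ⟨x, z, c, hbc, hax, hcz.symm, by rw [hN]; ext; simp; tauto⟩
    · exact ⟨a, z, c, hac, hax.symm, hcz.symm, hN⟩
    · exact absurd hcz (hirr)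
  · rcases hy with rfl | rfl | rfl
    · exact ⟨b, y, x, hbc, hby.symm, hax, by rw [hN]; ext; simp; tauto⟩
    · exact absurd hby (hirr)
    · exact ⟨a, y, b, hab, hax.symm, hby.symm, by rw [hN]; ext; simp; tauto⟩

/-- A triangle avoiding `v` survives. If an edge is new or its triangle used `v`, both ends are
neighbours of `v`, and the third neighbour of `v` completes a triangle. -/
theorem EveryEdgeInTriangle.eliminate {G : SimpleGraph V} (htri : G.EveryEdgeInTriangle)
    {v a b c : V} (hac : a ≠ c) (hba : G.Adj b a) (hbc : G.Adj b c)
    (hN : ∀ x, G.Adj v x ↔ x = a ∨ x = b ∨ x = c) : (G.eliminate v).EveryEdgeInTriangle := by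
  rw [everyEdgeInTriangle_iff] at htri ⊢
  have hne : ∀ x, G.Adj v x → x ≠ v := fun x h => h.ne'
  have hclique : ∀ x y : {x // x ≠ v}, x ≠ y → G.Adj v x → G.Adj v y →
      ∃ w, (G.eliminate v).Adj x w ∧ (G.eliminate v).Adj y w := by
    intro x y hxy hx hy
    obtain ⟨w, hw, hwx, hwy⟩ : ∃ w, G.Adj v w ∧ x.1 ≠ w ∧ y.1 ≠ w := by
      have hxy' : x.1 ≠ y.1 := fun e => hxy (Subtype.ext e)
      have hab := hba.ne
      have hcb := hbc.ne
      have h1 := (hN a).2 (by simp)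
      have h2 := (hN b).2 (by simp)
      have h3 := (hN c).2 (by simp)
      have hx' := (hN _).1 hx
      have hy' := (hN _).1 hy
      grind
    exact ⟨⟨w, hw.ne'⟩, ⟨fun e => hwx (congrArg _ e), Or.inr ⟨hx, hw⟩⟩,
      ⟨fun e => hwy (congrArg _ e), Or.inr ⟨hy, hw⟩⟩⟩
  rintro x y ⟨hxy, h | ⟨hx, hy⟩⟩
  · obtain ⟨w, hxw, hyw⟩ := htri _ _ h
    by_cases hwv : w = v
    · subst hwv
      exact hclique x y hxy hxw.symm hyw.symm
    · exact ⟨⟨w, hwv⟩, Adj.eliminate hxw, Adj.eliminate hyw⟩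
  · exact hclique x y hxy hx hy

/-! ### Edge count under elimination -/

section Count

variable [Fintype V] [DecidableEq V] {G : SimpleGraph V} [DecidableRel G.Adj] {v a b c : V}

theorem card_edgeFinset_sdiff_incidenceFinset :
    (G.edgeFinset \ G.incidenceFinset v).card + G.degree v = G.edgeFinset.card := by
  rw [← card_incidenceFinset_eq_degree]
  exact Finset.card_sdiff_add_card_eq_card (G.incidenceFinset_subset v)

variable [DecidableRel (G.eliminate v).Adj]

/-- Since `ba` and `bc` are already edges, `ac` is the only edge that elimination can create. -/
theorem map_edgeFinset_eliminate_subset (hba : G.Adj b a) (hbc : G.Adj b c)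
    (hN : ∀ x, G.Adj v x ↔ x = a ∨ x = b ∨ x = c) :
    (G.eliminate v).edgeFinset.map (Function.Embedding.subtype _).sym2Map ⊆
      insert s(a, c) (G.edgeFinset \ G.incidenceFinset v) := by
  intro e he
  obtain ⟨e', he', rfl⟩ := Finset.mem_map.1 he
  induction e' with
  | h x y =>
    rw [mem_edgeFinset, mem_edgeSet, eliminate_adj] at he'
    obtain ⟨hxy, h⟩ := he'
    have hxy' : x.1 ≠ y.1 := fun e => hxy (Subtype.ext e)
    have hG : G.Adj x y ∨ s(x.1, y.1) = s(a, c) := by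
      rcases h with h | ⟨hx, hy⟩
      · exact Or.inl h
      · rw [hN] at hx hy
        have := hba.symm
        have := hbc.symm
        rw [Sym2.eq_iff]
        grind
    change s(x.1, y.1) ∈ _
    rw [Finset.mem_insert, Finset.mem_sdiff, mem_edgeFinset, mem_edgeSet, mem_incidenceFinset]
    rcases hG with hG | hG
    · refine Or.inr ⟨hG, fun hv => ?_⟩
      rcases Sym2.mem_iff.1 hv.2 with e | e
      · exact x.2 e.symm
      · exact y.2 e.symm
    · exact Or.inl hG

theorem card_edgeFinset_eliminate_add_two_le (hv : G.degree v = 3) (hba : G.Adj b a)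
    (hbc : G.Adj b c) (hN : ∀ x, G.Adj v x ↔ x = a ∨ x = b ∨ x = c) :
    (G.eliminate v).edgeFinset.card + 2 ≤ G.edgeFinset.card := by
  have h1 := Finset.card_le_card (map_edgeFinset_eliminate_subset hba hbc hN)
  have h2 := card_edgeFinset_sdiff_incidenceFinset (G := G) (v := v)
  have h3 := Finset.card_insert_le s(a, c) (G.edgeFinset \ G.incidenceFinset v)
  rw [Finset.card_map] at h1
  omega

theorem card_edgeFinset_eliminate_add_three_le (hv : G.degree v = 3) (hba : G.Adj b a)
    (hbc : G.Adj b c) (hac : G.Adj a c) (hN : ∀ x, G.Adj v x ↔ x = a ∨ x = b ∨ x = c) :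
    (G.eliminate v).edgeFinset.card + 3 ≤ G.edgeFinset.card := by
  have h1 := Finset.card_le_card (map_edgeFinset_eliminate_subset hba hbc hN)
  have h2 := card_edgeFinset_sdiff_incidenceFinset (G := G) (v := v)
  have hmem : s(a, c) ∈ G.edgeFinset \ G.incidenceFinset v := by
    rw [Finset.mem_sdiff, mem_edgeFinset, mem_edgeSet, mem_incidenceFinset]
    refine ⟨hac, fun h => ?_⟩
    have := (hN v).not.1 (G.irrefl)
    rcases Sym2.mem_iff.1 h.2 with e | e <;> tauto
  rw [Finset.card_map, Finset.insert_eq_of_mem hmem] at h1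
  omega

end Count

/-! ### The equality case -/

/-- A graph of minimum degree at least three with a dominating vertex and as few edges as these
allow has degree three at all other vertices. -/
theorem degree_eq_three_of_card_edgeFinset [Fintype V] {G : SimpleGraph V}
    [DecidableRel G.Adj] (hdeg : ∀ x, 3 ≤ G.degree x) {h : V} (hh : ∀ x, x ≠ h → G.Adj h x)
    (hE : G.edgeFinset.card + 2 = 2 * Fintype.card V) {x : V} (hx : x ≠ h) : G.degree x = 3 := by
  classical
  have hsum := G.sum_degrees_eq_twice_card_edges
  rw [← Finset.add_sum_erase _ _ (Finset.mem_univ h)] at hsum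
  have hhdeg : G.degree h = Fintype.card V - 1 := by
    have : G.neighborFinset h = Finset.univ.erase h := by
      ext y
      simp only [mem_neighborFinset, Finset.mem_erase, Finset.mem_univ, and_true]
      exact ⟨fun e => e.ne', hh y⟩
    rw [← card_neighborFinset_eq_degree, this, Finset.card_erase_of_mem (Finset.mem_univ _),
      Finset.card_univ]
  have hcard : (Finset.univ.erase h).card = Fintype.card V - 1 := by
    rw [Finset.card_erase_of_mem (Finset.mem_univ _), Finset.card_univ]
  have hpos : 0 < Fintype.card V := Fintype.card_pos_iff.2 ⟨h⟩
  -- With `n` vertices, the degree sum `4n - 4` minus the `n - 1` of `h` is `3(n - 1)`, so the lower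
  -- bound of three is attained everywhere else.
  have hconst : ∑ _y ∈ Finset.univ.erase h, 3 = ∑ y ∈ Finset.univ.erase h, G.degree y := by
    rw [Finset.sum_const, hcard, smul_eq_mul]
    omega
  exact ((Finset.sum_eq_sum_iff_of_le fun y _ => hdeg y).1 hconst x
    (Finset.mem_erase.2 ⟨hx, Finset.mem_univ _⟩)).symm

theorem adj_iff_of_degree_eq_three {G : SimpleGraph V} [G.LocallyFinite] {x p q r : V}
    (hx : G.degree x = 3) (hp : G.Adj x p) (hq : G.Adj x q) (hr : G.Adj x r) (hpq : p ≠ q)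
    (hpr : p ≠ r) (hqr : q ≠ r) {y : V} : G.Adj x y ↔ y = p ∨ y = q ∨ y = r := by
  classical
  have hsub : ({p, q, r} : Finset V) ⊆ G.neighborFinset x := by
    intro z hz
    simp only [Finset.mem_insert, Finset.mem_singleton] at hz
    rw [mem_neighborFinset]
    rcases hz with rfl | rfl | rfl <;> assumption
  have := Finset.eq_of_subset_of_card_le hsub (by
    rw [card_neighborFinset_eq_degree, hx, Finset.card_eq_three.2 ⟨p, q, r, hpq, hpr, hqr, rfl⟩])
  rw [← mem_neighborFinset, ← this]
  simp

/-- Let `v` have the neighbours `a`, `b`, `c`, inducing a path with middle vertex `b`. If all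
vertices other than `a` have degree three after eliminating `v`, then `b` dominates `G`. -/
theorem adj_of_dominating_eliminate_of_endpoint [Fintype V] [DecidableEq V] {G : SimpleGraph V}
    (htri : G.EveryEdgeInTriangle) {v a b c : V} [(G.eliminate v).LocallyFinite]
    (hconn : (G.eliminate v).IsVertexConnected 3) (hac : a ≠ c) (hnac : ¬ G.Adj a c)
    (hba : G.Adj b a) (hbc : G.Adj b c) (hN : ∀ x, G.Adj v x ↔ x = a ∨ x = b ∨ x = c)
    (hdom : ∀ x : {x // x ≠ v}, x.1 ≠ a → (G.eliminate v).degree x = 3) :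
    ∀ x, x ≠ b → G.Adj b x := by
  rw [everyEdgeInTriangle_iff] at htri
  have hva := (hN a).2 (by simp)
  have hvb := (hN b).2 (by simp)
  have hvc := (hN c).2 (by simp)
  let a' : {x // x ≠ v} := ⟨a, hva.ne'⟩
  let b' : {x // x ≠ v} := ⟨b, hvb.ne'⟩
  let c' : {x // x ≠ v} := ⟨c, hvc.ne'⟩
  have hab' : a' ≠ b' := fun e => hba.ne' (congrArg Subtype.val e)
  have hac' : a' ≠ c' := fun e => hac (congrArg Subtype.val e)
  have hbc' : b' ≠ c' := fun e => hbc.ne (congrArg Subtype.val e)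
  obtain ⟨d, hcd, hda, hdb⟩ : ∃ d, (G.eliminate v).Adj c' d ∧ d ≠ a' ∧ d ≠ b' := by
    by_contra! hcon
    have hsub : (G.eliminate v).neighborFinset c' ⊆ {a', b'} := by
      intro d hd
      rw [mem_neighborFinset] at hd
      rw [Finset.mem_insert, Finset.mem_singleton]
      exact or_iff_not_imp_left.2 (hcon d hd)
    have := (Finset.card_le_card hsub).trans Finset.card_le_two
    rw [card_neighborFinset_eq_degree, hdom c' hac.symm] at this
    omega
  have hdc : d ≠ c' := hcd.ne'
  have hvd : ¬ G.Adj v d := by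
    rw [hN]
    rintro (e | e | e)
    · exact hda (Subtype.ext e)
    · exact hdb (Subtype.ext e)
    · exact hdc (Subtype.ext e)
  have hGcd : G.Adj c d := hcd.2.resolve_right fun e => hvd e.2
  have hcN : ∀ y, (G.eliminate v).Adj c' y ↔ y = a' ∨ y = b' ∨ y = d := fun y =>
    adj_iff_of_degree_eq_three (hdom c' hac.symm) ⟨hac'.symm, Or.inr ⟨hvc, hva⟩⟩
      ⟨hbc'.symm, Or.inr ⟨hvc, hvb⟩⟩ hcd hab' hda.symm hdb.symm
  -- The apex of a triangle on `cd` in `G` cannot be `v` (not adjacent to `d`) or `a` (not adjacent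
  -- to `c`), so it is `b`.
  have hGbd : G.Adj b d := by
    obtain ⟨w, hcw, hdw⟩ := htri _ _ hGcd
    have hwv : w ≠ v := by
      rintro rfl
      exact hvd hdw.symm
    rcases (hcN ⟨w, hwv⟩).1 (Adj.eliminate hcw) with e | e | e
    · rw [show w = a from congrArg Subtype.val e] at hcw
      exact absurd hcw.symm hnac
    · rw [show w = b from congrArg Subtype.val e] at hdw
      exact hdw.symm
    · rw [show w = d.1 from congrArg Subtype.val e] at hdw
      exact absurd hdw G.irrefl
  have hbN : ∀ y, (G.eliminate v).Adj b' y ↔ y = a' ∨ y = c' ∨ y = d := fun y =>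
    adj_iff_of_degree_eq_three (hdom b' hba.ne) ⟨hab'.symm, Or.inr ⟨hvb, hva⟩⟩
      ⟨hbc', Or.inr ⟨hvb, hvc⟩⟩ (Adj.eliminate hGbd) hac' hda.symm hdc.symm
  -- All neighbours of `b'` and `c'` lie in `{a', b', c', d}`, so any further vertex would be
  -- separated from them by `{a', d}`.
  have hall : ∀ y : {x // x ≠ v}, y = a' ∨ y = b' ∨ y = c' ∨ y = d := by
    intro y
    by_cases hy : y ∈ ({a', d} : Finset _)
    · simp only [Finset.mem_insert, Finset.mem_singleton] at hy
      tauto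
    · have := (isVertexConnected_iff.1 hconn).2 {a', d}
        (Finset.card_le_two.trans_lt (by norm_num)) {b', c'} ?_ b'
        (by simp [hab'.symm, hdb.symm]) y hy (by simp)
      · simp only [Set.mem_insert_iff, Set.mem_singleton_iff] at this
        tauto
      · intro x _ z hz hxz hx
        simp only [Finset.mem_insert, Finset.mem_singleton, Set.mem_insert_iff,
          Set.mem_singleton_iff] at hx hz ⊢
        rcases hx with rfl | rfl
        · have := (hbN z).1 hxz
          tauto
        · have := (hcN z).1 hxz
          tauto
  intro x hxb
  by_cases hxv : x = v
  · exact hxv ▸ hvb.symm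
  · rcases hall ⟨x, hxv⟩ with e | e | e | e
    · rwa [show x = a from congrArg Subtype.val e]
    · exact absurd (congrArg Subtype.val e) hxb
    · rwa [show x = c from congrArg Subtype.val e]
    · rwa [show x = d.1 from congrArg Subtype.val e]

/-- Let `v` have the neighbours `a`, `b`, `c`, inducing a path with middle vertex `b`. If
eliminating `v` yields a graph with a dominating vertex and degree three elsewhere, then `b`
dominates `G`. -/
theorem adj_of_dominating_eliminate [Fintype V] [DecidableEq V] {G : SimpleGraph V}
    (htri : G.EveryEdgeInTriangle) {v a b c : V} [(G.eliminate v).LocallyFinite]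
    (hconn : (G.eliminate v).IsVertexConnected 3) (hac : a ≠ c) (hnac : ¬ G.Adj a c)
    (hba : G.Adj b a) (hbc : G.Adj b c) (hN : ∀ x, G.Adj v x ↔ x = a ∨ x = b ∨ x = c)
    {h : {x // x ≠ v}} (hh : ∀ x, x ≠ h → (G.eliminate v).Adj h x)
    (hdeg : ∀ x, x ≠ h → (G.eliminate v).degree x = 3) :
    ∀ x, x ≠ b → G.Adj b x := by
  have hva := (hN a).2 (by simp)
  have hvb := (hN b).2 (by simp)
  have hvc := (hN c).2 (by simp)
  by_cases hha : h.1 = a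
  · exact adj_of_dominating_eliminate_of_endpoint htri hconn hac hnac hba hbc hN
      fun x hx => hdeg x fun e => hx (e ▸ hha)
  by_cases hhc : h.1 = c
  · exact adj_of_dominating_eliminate_of_endpoint htri hconn hac.symm (fun e => hnac e.symm) hbc hba
      (fun x => (hN x).trans (by tauto)) fun x hx => hdeg x fun e => hx (e ▸ hhc)
  by_cases hhb : h.1 = b
  · intro x hxb
    by_cases hxv : x = v
    · exact hxv ▸ hvb.symm
    · rcases (hh ⟨x, hxv⟩ fun e => hxb (by rw [← hhb, ← e])).2 with e | ⟨_, e⟩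
      · exact hhb ▸ e
      · rcases (hN _).1 e with e | e | e
        · rwa [show x = a from e]
        · exact absurd e hxb
        · rwa [show x = c from e]
  let a' : {x // x ≠ v} := ⟨a, hva.ne'⟩
  let b' : {x // x ≠ v} := ⟨b, hvb.ne'⟩
  let c' : {x // x ≠ v} := ⟨c, hvc.ne'⟩
  have hab' : a' ≠ b' := fun e => hba.ne' (congrArg Subtype.val e)
  have hac' : a' ≠ c' := fun e => hac (congrArg Subtype.val e)
  have hbc' : b' ≠ c' := fun e => hbc.ne (congrArg Subtype.val e)
  have hah : a' ≠ h := fun e => hha (congrArg Subtype.val e).symm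
  have hbh : b' ≠ h := fun e => hhb (congrArg Subtype.val e).symm
  have hch : c' ≠ h := fun e => hhc (congrArg Subtype.val e).symm
  have haN : ∀ y, (G.eliminate v).Adj a' y ↔ y = b' ∨ y = c' ∨ y = h := fun y =>
    adj_iff_of_degree_eq_three (hdeg a' hah) ⟨hab', Or.inr ⟨hva, hvb⟩⟩
      ⟨hac', Or.inr ⟨hva, hvc⟩⟩ (hh _ hah).symm hbc' hbh hch
  have hbN : ∀ y, (G.eliminate v).Adj b' y ↔ y = a' ∨ y = c' ∨ y = h := fun y =>
    adj_iff_of_degree_eq_three (hdeg b' hbh) ⟨hab'.symm, Or.inr ⟨hvb, hva⟩⟩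
      ⟨hbc', Or.inr ⟨hvb, hvc⟩⟩ (hh _ hbh).symm hac' hah hch
  have hcN : ∀ y, (G.eliminate v).Adj c' y ↔ y = a' ∨ y = b' ∨ y = h := fun y =>
    adj_iff_of_degree_eq_three (hdeg c' hch) ⟨hac'.symm, Or.inr ⟨hvc, hva⟩⟩
      ⟨hbc'.symm, Or.inr ⟨hvc, hvb⟩⟩ (hh _ hch).symm hab' hah hbh
  -- Here `h` is not a neighbour of `v`, and the clique `a'`, `b'`, `c'` meets the rest only in `h`,
  -- which would be a cut vertex if anything else existed.
  have hall : ∀ y : {x // x ≠ v}, y = a' ∨ y = b' ∨ y = c' ∨ y = h := by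
    intro y
    by_cases hy : y ∈ ({h} : Finset _)
    · simp only [Finset.mem_singleton] at hy
      tauto
    · have := (isVertexConnected_iff.1 hconn).2 {h}
        (by rw [Finset.card_singleton]; norm_num) {a', b', c'} ?_ b'
        (by simpa using hbh) y hy (by simp)
      · simp only [Set.mem_insert_iff, Set.mem_singleton_iff] at this
        tauto
      · intro x _ z hz hxz hx
        simp only [Finset.mem_singleton, Set.mem_insert_iff, Set.mem_singleton_iff] at hx hz ⊢
        rcases hx with rfl | rfl | rfl
        · have := (haN z).1 hxz
          tauto
        · have := (hbN z).1 hxz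
          tauto
        · have := (hcN z).1 hxz
          tauto
  intro x hxb
  by_cases hxv : x = v
  · exact hxv ▸ hvb.symm
  · rcases hall ⟨x, hxv⟩ with e | e | e | e
    · rwa [show x = a from congrArg Subtype.val e]
    · exact absurd (congrArg Subtype.val e) hxb
    · rwa [show x = c from congrArg Subtype.val e]
    · rw [show x = h.1 from congrArg Subtype.val e]
      refine (hh _ hbh).symm.2.resolve_right fun e => ?_
      rcases (hN _).1 e.2 with e | e | e
      · exact hha e
      · exact hhb e
      · exact hhc e

/-! ### The induction -/

/-- A `3`-connected graph in which every edge lies in a triangle has at least `2n - 2` edges, and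
has a dominating vertex in case of equality. -/
theorem IsVertexConnected.two_mul_card_le_and_exists_dominating (n : ℕ) {V : Type*} [Fintype V]
    [DecidableEq V] (G : SimpleGraph V) [DecidableRel G.Adj] (hn : Fintype.card V = n)
    (hconn : G.IsVertexConnected 3) (htri : G.EveryEdgeInTriangle) :
    2 * n ≤ G.edgeFinset.card + 2 ∧
      (G.edgeFinset.card + 2 = 2 * n → ∃ h, ∀ x, x ≠ h → G.Adj h x) := by
  induction n generalizing V with
  | zero => exact absurd hconn.1 (by omega)
  | succ m ih =>
    have hdeg := hconn.le_degree
    have hcard := hconn.1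
    by_cases h3 : ∃ v, G.degree v = 3
    · obtain ⟨v, hv⟩ := h3
      -- On four vertices `G` is complete; elimination would leave three vertices, too few to be
      -- `3`-connected.
      by_cases hm : m = 3
      · have hadj : ∀ v x, x ≠ v → G.Adj v x := by
          intro v x hx
          have hsub : G.neighborFinset v ⊆ Finset.univ.erase v := by
            intro y hy
            rw [mem_neighborFinset] at hy
            exact Finset.mem_erase.2 ⟨hy.ne', Finset.mem_univ _⟩
          have := Finset.eq_of_subset_of_card_le hsub (by
            rw [Finset.card_erase_of_mem (Finset.mem_univ _), Finset.card_univ,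
              card_neighborFinset_eq_degree]
            have := hdeg v
            omega)
          rw [← mem_neighborFinset, this]
          exact Finset.mem_erase.2 ⟨hx, Finset.mem_univ _⟩
        refine ⟨?_, fun _ => ⟨v, hadj v⟩⟩
        have hsum := G.sum_degrees_eq_twice_card_edges
        have := Finset.card_nsmul_le_sum Finset.univ (fun x => G.degree x) 3 fun x _ => hdeg x
        rw [Finset.card_univ, smul_eq_mul] at this
        omega
      · obtain ⟨a, b, c, hac, hba, hbc, hN⟩ :=
          exists_neighborFinset_eq_of_degree_eq_three htri hv
        have hN' : ∀ x, G.Adj v x ↔ x = a ∨ x = b ∨ x = c := by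
          intro x
          rw [← mem_neighborFinset, hN]
          simp
        classical
        have hconn' := hconn.eliminate v (by omega)
        have hcard' : Fintype.card {x // x ≠ v} = m := by
          rw [Fintype.card_subtype_compl, Fintype.card_subtype_eq]
          omega
        obtain ⟨hle, heq⟩ := ih (G.eliminate v) hcard' hconn' (htri.eliminate hac hba hbc hN')
        have hE := card_edgeFinset_eliminate_add_two_le hv hba hbc hN'
        refine ⟨by omega, fun hEq => ?_⟩
        obtain ⟨h, hh⟩ := heq (by omega)
        refine ⟨b, adj_of_dominating_eliminate htri hconn' hac (fun e => ?_) hba hbc hN' hh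
          fun x hx => degree_eq_three_of_card_edgeFinset hconn'.le_degree hh (by omega) hx⟩
        -- If `ac` were an edge, elimination would lose three edges and violate the bound for `m`.
        have := card_edgeFinset_eliminate_add_three_le hv hba hbc e hN'
        omega
    · have hsum := G.sum_degrees_eq_twice_card_edges
      have := Finset.card_nsmul_le_sum Finset.univ (fun x => G.degree x) 4 fun x _ =>
        lt_of_le_of_ne (hdeg x) fun e => h3 ⟨x, e.symm⟩
      rw [Finset.card_univ, smul_eq_mul] at this
      exact ⟨by omega, by omega⟩

/-! ### The wheel -/

theorem nonempty_iso_wheelGraph_of_dominating [Fintype V] [DecidableEq V] {G : SimpleGraph V}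
    [DecidableRel G.Adj] (hconn : G.IsVertexConnected 3) {h : V}
    (hh : ∀ x, x ≠ h → G.Adj h x) (hE : G.edgeFinset.card + 2 = 2 * Fintype.card V) :
    Nonempty (wheelGraph (Fintype.card V) ≃g G) := by
  classical
  have hcard : Fintype.card {x | x ∉ ({h} : Finset V)} = Fintype.card V - 1 := by
    simp [Fintype.card_subtype, Finset.filter_ne']
  -- Every other vertex has degree three and loses exactly the neighbour `h`.
  have hreg : (G.induce {x | x ∉ ({h} : Finset V)}).IsRegularOfDegree 2 := by
    intro x
    have hxh : x.1 ≠ h := by simpa using x.2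
    have h3 := degree_eq_three_of_card_edgeFinset hconn.le_degree hh hE hxh
    have hmap : ((G.induce {x | x ∉ ({h} : Finset V)}).neighborFinset x).map
        (Function.Embedding.subtype _) = (G.neighborFinset x).erase h := by
      ext y
      simp [and_comm]
    rw [← card_neighborFinset_eq_degree, ← Finset.card_map, hmap,
      Finset.card_erase_of_mem ((mem_neighborFinset _ _ _).2 (hh _ hxh).symm),
      card_neighborFinset_eq_degree, h3]
  obtain ⟨f⟩ := (hconn.2 {h} (by simp)).nonempty_iso_cycleGraph hreg
  rw [hcard] at f
  let e : Fin 1 ⊕ Fin (Fintype.card V - 1) → V := Sum.elim (fun _ => h) fun i => f i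
  have hfne : ∀ i, (f i).1 ≠ h := fun i => by simpa using (f i).2
  have he : Function.Bijective e := by
    constructor
    · rintro (i | i) (j | j) hij
      · exact congrArg _ (Subsingleton.elim _ _)
      · exact absurd hij.symm (hfne j)
      · exact absurd hij (hfne i)
      · exact congrArg _ (f.injective (Subtype.ext hij))
    · intro x
      by_cases hx : x = h
      · exact ⟨Sum.inl 0, hx.symm⟩
      · obtain ⟨i, hi⟩ := f.surjective ⟨x, by simpa using hx⟩
        exact ⟨Sum.inr i, congrArg Subtype.val hi⟩
  refine ⟨⟨Equiv.ofBijective e he, ?_⟩⟩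
  rintro (i | i) (j | j)
  · simp [e, wheelGraph, join, Subsingleton.elim i j]
  · simpa [e, wheelGraph, join] using hh _ (hfne j)
  · simpa [e, wheelGraph, join] using (hh _ (hfne i)).symm
  · have := f.map_adj_iff (v := i) (w := j)
    simpa [e, wheelGraph, join] using this

/-- The hub has degree `n - 1` and each of the `n - 1` rim vertices degree three, so the degree sum
is `4(n - 1)`. The rim has at least three vertices because `4 ≤ n`. -/
theorem card_edgeFinset_of_iso_wheelGraph [Fintype V] {G : SimpleGraph V} [DecidableRel G.Adj]
    {n : ℕ} (hn : 4 ≤ n) (f : G ≃g wheelGraph n) : G.edgeFinset.card = 2 * n - 2 := by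
  classical
  rw [f.card_edgeFinset_eq]
  obtain ⟨m, rfl⟩ := Nat.exists_eq_add_of_le' hn
  have hsum := (wheelGraph (m + 4)).sum_degrees_eq_twice_card_edges
  have hl : ∀ i, (wheelGraph (m + 4)).degree (Sum.inl i) = m + 3 := by
    intro i
    have : (wheelGraph (m + 4)).neighborFinset (Sum.inl i) =
        Finset.univ.map Function.Embedding.inr := by
      ext (j | j) <;> rw [mem_neighborFinset]
      · simp [wheelGraph, join, Subsingleton.elim i j]
      · simp [wheelGraph, join]
    rw [← card_neighborFinset_eq_degree, this]
    simp
  have hr : ∀ i, (wheelGraph (m + 4)).degree (Sum.inr i) = 3 := by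
    intro i
    have : (wheelGraph (m + 4)).neighborFinset (Sum.inr i) =
        insert (Sum.inl 0)
          (((cycleGraph (m + 3)).neighborFinset i).map Function.Embedding.inr) := by
      ext (j | j) <;> rw [mem_neighborFinset]
      · simp [wheelGraph, join, Subsingleton.elim j 0]
      · simp [wheelGraph, join]
    rw [← card_neighborFinset_eq_degree, this, Finset.card_insert_of_notMem (by simp),
      Finset.card_map, card_neighborFinset_eq_degree, cycleGraph_degree_three_le]
  rw [Fintype.sum_sum_type] at hsum
  simp only [hl, hr, Finset.sum_const, Finset.card_univ, Fintype.card_fin, smul_eq_mul] at hsum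
  omega

end SimpleGraph

theorem lemma2 {V : Type*} [Fintype V] [DecidableEq V] (G : SimpleGraph V) [DecidableRel G.Adj]
    (n : ℕ) (hn : Fintype.card V = n) (hconn : G.IsVertexConnected 3)
    (htri : G.EveryEdgeInTriangle) :
    2 * n - 2 ≤ G.edgeFinset.card ∧
      (G.edgeFinset.card = 2 * n - 2 ↔ Nonempty (G ≃g SimpleGraph.wheelGraph n)) := by
  obtain ⟨hle, hdom⟩ := SimpleGraph.IsVertexConnected.two_mul_card_le_and_exists_dominating
    n G hn hconn htri
  -- This gives `n > 3`, so the natural subtraction in `2 * n - 2` does not truncate.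
  have hcard := hconn.1
  refine ⟨by omega, fun hE => ?_, fun ⟨f⟩ =>
    SimpleGraph.card_edgeFinset_of_iso_wheelGraph (by omega) f⟩
  obtain ⟨h, hh⟩ := hdom (by omega)
  obtain ⟨f⟩ := SimpleGraph.nonempty_iso_wheelGraph_of_dominating hconn hh (by omega)
  exact ⟨hn ▸ f.symm⟩
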